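/- **Problem.** Consider $$\mathcal P^{spd}:\quad \min_{x,y}\ f(x,y)=f_0(y)+\sum_{i=1}^I f_i(x_i,y)$$ subject to $A_{i,x}x_i+A_{i,y}y+b_i=0$, $\tilde g_i(x_i,y)\preceq 0$, $g_i(x_i)\preceq 0$, $x_i\in\mathcal X_i$ $(i=1,\dots,I)$, $g_0(y)\preceq 0$, $y\in\mathcal Y$, where $x=(x_1,\dots,x_I)$, $x_i\in\mathbb R^{n_i}$, $y\in\mathbb R^{n_0}$. Assume: $\mathcal X_i\subseteq\mathcal U_i\subseteq\mathbb R^{n_i}$ and $\mathcal Y\subseteq\mathcal V\subseteq\mathbb R^{n_0}$ with $\mathcal X_i,\mathcal Y$ nonempty, closed, convex and $\mathcal U_i,\mathcal V$ open; $f_i,\tilde g_i$ are $C^1$ on $\mathcal U_i\times\mathcal V$, $g_i$ on $\mathcal U_i$, and $f_0,g_0$ on $\mathcal V$; $\nabla f_i$ is Lipschitz on $\mathcal X_i\times\mathcal Y$ and $\nabla f_0$ is Lipschitz on $\mathcal Y$; and $f$ is bounded below on the feasible set. Collect all inequality constraints as $g(z)\preceq0$, all equality constraints as $h(z)=0$,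 with $z=(x,y)$ and $\mathcal Z=\prod_i\mathcal X_i\times\mathcal Y$. A feasible $z$ is *stationary* if there are $\mu\succeq0$ and $\lambda$ with $\mu_jg_j(z)=0$ for all $j$ and $(\nabla f(z)+\nabla g(z)\mu+\nabla h(z)\lambda)^T(z'-z)\ge0$ for all $z'\in\mathcal Z$. It is *regular* if the only $(\mu,\lambda)$ with $\mu\succeq0$, $\mu_j=0$ whenever $g_j(z)\neq0$, and $(\nabla g(z)\mu+\nabla h(z)\lambda)^T(z'-z)\ge0$ for all $z'\in\mathcal Z$ is $(0,0)$. Assume that every feasible point of $\mathcal P^{spd}$ is regular. **Approximations.** Let $F_0(y;w)$, $F_i(x_i,y;u_i,w)$, $\widetilde G_i(x_i,y;u_i,w)$, $G_i(x_i;u_i)$, $G_0(y;w)$ be approximations of $f_0,f_i,\tilde g_i,g_i,g_0$. For each pair $(\phi,\Phi)=(f_0,F_0)$ or $(f_i,F_i)$, with $\mathcal C\subseteq\mathcal O$ standing for $\mathcal Y\subseteq\mathcal V$ or $\mathcal X_i\times\mathcal Y\subseteq\mathcal U_i\times\mathcal V$: for every $w\in\mathcal C$, $\Phi(\cdot;w)$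 is $C^1$ on $\mathcal O$; there is $c>0$ with $(v-v')^T(\nabla_v\Phi(v;w)-\nabla_v\Phi(v';w))\ge c\|v-v'\|_2^2$ for all $v,v',w\in\mathcal C$; $\nabla_v\Phi(w;w)=\nabla\phi(w)$ for $w\in\mathcal C$; and $\nabla_v\Phi(\cdot;\cdot)$ is continuous on $\mathcal O\times\mathcal C$. For each pair $(\phi,\Phi)=(\tilde g_i,\widetilde G_i)$, $(g_i,G_i)$ or $(g_0,G_0)$, with $\mathcal C=\mathcal X_i\times\mathcal Y$, $\mathcal X_i$ or $\mathcal Y$ respectively: $\Phi(\cdot;w)$ is (componentwise) convex on $\mathcal C$ for every $w\in\mathcal C$; $\Phi(w;w)=\phi(w)$ for $w\in\mathcal C$; $\Phi(v;w)\succeq\phi(v)$ for $v,w\in\mathcal C$; $\nabla_v\Phi(w;w)=\nabla\phi(w)$ for $w\in\mathcal C$; and $\Phi$ and $\nabla_v\Phi$ exist and are continuous on $\mathcal C\times\mathcal C$. **SPD-M.** Let $(x^{(0)},y^{(0)})$ be feasible and let $\gamma^{(k)}\in(0,1]$ satisfy $\gamma^{(k)}\to0$ and $\sum_k\gamma^{(k)}=\infty$.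 At step $k$, for fixed $y$, let $x_i^{*,(k)}(y)$ be the optimal point of the subproblem $\min_{x_i}F_i(x_i,y;x_i^{(k)},y^{(k)})$ subject to $\widetilde G_i(x_i,y;x_i^{(k)},y^{(k)})\preceq0$, $A_{i,x}x_i+A_{i,y}y+b_i=0$, $G_i(x_i;x_i^{(k)})\preceq0$, $x_i\in\mathcal X_i$. Let $y^{*,(k)}$ be the optimal point of the master problem $\min_y F_0(y;y^{(k)})+\sum_iF_i(x_i^{*,(k)}(y),y;x_i^{(k)},y^{(k)})$ over those $y\in\mathcal Y$ with $G_0(y;y^{(k)})\preceq0$ for which all subproblems are feasible. Set $$(x^{(k+1)},y^{(k+1)})=(x^{(k)},y^{(k)})+\gamma^{(k)}\big((x^{*,(k)}(y^{*,(k)}),y^{*,(k)})-(x^{(k)},y^{(k)})\big).$$ **Claim.** Suppose that the iterates do not diverge to infinity, i.e. it is not the case that $\|(x^{(k)},y^{(k)})\|\to\infty$ (equivalently, the sequence has a limit point at all). Then at least one limit point of $\{(x^{(k)},y^{(k)})\}_{k\in\mathbb N}$ is a stationary point of $\mathcal P^{spd}$. -/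

import Mathlib

open scoped Matrix
open Filter Topology

noncomputable section

/-! ### Constrained problems, KKT conditions, regularity

A problem `min f(z)` subject to `g j z ≤ 0` (`j : κ`), `h l z = 0` (`l : η`), `z ∈ X`.
Gradients enter only through their pairing with a direction, so they are written as
Fréchet derivatives. -/

section Generic

variable {E κ η : Type} [NormedAddCommGroup E] [NormedSpace ℝ E] [Fintype κ] [Fintype η]

/-- Feasibility of `z`. -/
def IsFeasiblePoint (g : κ → E → ℝ) (h : η → E → ℝ) (X : Set E) (z : E) : Prop :=
  (∀ j, g j z ≤ 0) ∧ (∀ l, h l z = 0) ∧ z ∈ X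

/-- `z` is a stationary (KKT) point: multipliers `μ`, `lam` exist that satisfy the
KKT conditions together with `z`. -/
def IsStationaryPoint (f : E → ℝ) (g : κ → E → ℝ) (h : η → E → ℝ) (X : Set E) (z : E) : Prop :=
  ∃ (μ : κ → ℝ) (lam : η → ℝ),
    (∀ z' ∈ X, 0 ≤ (fderiv ℝ f z + ∑ j, μ j • fderiv ℝ (g j) z
        + ∑ l, lam l • fderiv ℝ (h l) z) (z' - z)) ∧
    (∀ j, μ j * g j z = 0) ∧
    (∀ j, 0 ≤ μ j) ∧
    IsFeasiblePoint g h X z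

/-- The Mangasarian-Fromovitz constraint qualification at `z` (in its dual form). -/
def IsRegularPoint (g : κ → E → ℝ) (h : η → E → ℝ) (X : Set E) (z : E) : Prop :=
  ∀ (μ : κ → ℝ) (lam : η → ℝ),
    (∀ z' ∈ X, 0 ≤ (∑ j, μ j • fderiv ℝ (g j) z + ∑ l, lam l • fderiv ℝ (h l) z) (z' - z)) →
    (∀ j, 0 ≤ μ j) →
    (∀ j, g j z ≠ 0 → μ j = 0) →
    μ = 0 ∧ lam = 0

/-- `F x z` (read `F(x; z)`) is an admissible strongly convex approximation of `f` on `X`,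
where `X` lies in the open set `U`. -/
structure IsObjectiveSurrogate (U X : Set E) (f : E → ℝ) (F : E → E → ℝ) : Prop where
  contDiff : ∀ z ∈ X, ContDiffOn ℝ 1 (fun x => F x z) U
  stronglyConvex : ∃ c : ℝ, 0 < c ∧ ∀ z ∈ X, ∀ x ∈ X, ∀ x' ∈ X,
    c * ‖x - x'‖ ^ 2 ≤
      (fderiv ℝ (fun w => F w z) x - fderiv ℝ (fun w => F w z) x') (x - x')
  grad_eq : ∀ z ∈ X, fderiv ℝ (fun w => F w z) z = fderiv ℝ f z
  grad_continuous :
    ContinuousOn (fun p : E × E => fderiv ℝ (fun w => F w p.2) p.1) (U ×ˢ X)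

/-- `G x z` (read `G(x; z)`) is an admissible convex majorizing approximation of the
(scalar) constraint function `g` on `X`. -/
structure IsConstraintSurrogate (X : Set E) (g : E → ℝ) (G : E → E → ℝ) : Prop where
  convex : ∀ z ∈ X, ConvexOn ℝ X (fun x => G x z)
  value_eq : ∀ z ∈ X, G z z = g z
  majorizes : ∀ x ∈ X, ∀ z ∈ X, 0 ≤ G x z - g x
  continuous : ContinuousOn (fun p : E × E => G p.1 p.2) (X ×ˢ X)
  differentiable : ∀ x ∈ X, ∀ z ∈ X, DifferentiableAt ℝ (fun w => G w z) x
  grad_eq : ∀ z ∈ X, fderiv ℝ (fun w => G w z) z = fderiv ℝ g z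
  grad_continuous :
    ContinuousOn (fun p : E × E => fderiv ℝ (fun w => G w p.2) p.1) (X ×ˢ X)

end Generic

/-! ### The nonconvex problem with coupling variable `y` -/

/-- `ℝⁿ` with the `ℓ₂` norm. -/
abbrev Vec (n : ℕ) : Type := EuclideanSpace ℝ (Fin n)

/-- `ℝⁿ × ℝᵐ` with the `ℓ₂` norm. -/
abbrev VecPair (n m : ℕ) : Type := WithLp 2 (Vec n × Vec m)

/-- The pair `(x, y)` as a point of `ℝⁿ × ℝᵐ`. -/
abbrev mkPair {n m : ℕ} (x : Vec n) (y : Vec m) : VecPair n m := WithLp.toLp 2 (x, y)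

/-- The set `A × B` in `ℝⁿ × ℝᵐ`. -/
def pairSet {n m : ℕ} (A : Set (Vec n)) (B : Set (Vec m)) : Set (VecPair n m) :=
  {p | p.fst ∈ A ∧ p.snd ∈ B}

/-- The data of the problem
`min f₀(y) + ∑ᵢ fᵢ(xᵢ, y)` subject to `Aᵢₓ xᵢ + Aᵢᵧ y + bᵢ = 0`, `g̃ᵢ(xᵢ, y) ≤ 0`,
`gᵢ(xᵢ) ≤ 0`, `xᵢ ∈ Xᵢ` (`i = 1, …, I`), `g₀(y) ≤ 0`, `y ∈ Y`.
The functions are only used on the sets `Uᵢ × V`, `Uᵢ`, `V`. -/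
structure SPDProblem where
  /-- number of blocks -/
  I : ℕ
  /-- dimension of the block `xᵢ` -/
  n : Fin I → ℕ
  /-- dimension of `y` -/
  n₀ : ℕ
  /-- number of coupling inequality constraints of block `i` -/
  rc : Fin I → ℕ
  /-- number of coupling linear equality constraints of block `i` -/
  m : Fin I → ℕ
  /-- number of decoupled inequality constraints on `xᵢ` -/
  r : Fin I → ℕ
  /-- number of inequality constraints on `y` -/
  r₀ : ℕ
  U : ∀ i, Set (Vec (n i))
  V : Set (Vec n₀)
  X : ∀ i, Set (Vec (n i))
  Y : Set (Vec n₀)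
  f : ∀ i, VecPair (n i) n₀ → ℝ
  f₀ : Vec n₀ → ℝ
  /-- coupling inequality constraints `g̃ᵢ` -/
  gc : ∀ i, Fin (rc i) → VecPair (n i) n₀ → ℝ
  g : ∀ i, Fin (r i) → Vec (n i) → ℝ
  g₀ : Fin r₀ → Vec n₀ → ℝ
  Ax : ∀ i, Matrix (Fin (m i)) (Fin (n i)) ℝ
  Ay : ∀ i, Matrix (Fin (m i)) (Fin n₀) ℝ
  b : ∀ i, Fin (m i) → ℝ

namespace SPDProblem

variable (P : SPDProblem)

/-- The space of `x = (x₁, …, x_I)`. -/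
abbrev XSpace : Type := ∀ i, Vec (P.n i)

/-- The space of `(x, y)`. -/
abbrev Space : Type := P.XSpace × Vec P.n₀

/-- The set `X₁ × ⋯ × X_I × Y`. -/
def convexSet : Set P.Space := {z | (∀ i, z.1 i ∈ P.X i) ∧ z.2 ∈ P.Y}

/-- The objective `f(x, y) = f₀(y) + ∑ᵢ fᵢ(xᵢ, y)`. -/
def objective (z : P.Space) : ℝ := P.f₀ z.2 + ∑ i, P.f i (mkPair (z.1 i) z.2)

/-- Indices of all scalar inequality constraints: coupling, on the `xᵢ`, on `y`. -/
abbrev IneqIdx : Type := (Σ i, Fin (P.rc i)) ⊕ (Σ i, Fin (P.r i)) ⊕ Fin P.r₀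

/-- Indices of all scalar equality constraints. -/
abbrev EqIdx : Type := Σ i, Fin (P.m i)

/-- All inequality constraint functions of the problem. -/
def ineq : P.IneqIdx → P.Space → ℝ
  | Sum.inl ⟨i, j⟩, z => P.gc i j (mkPair (z.1 i) z.2)
  | Sum.inr (Sum.inl ⟨i, j⟩), z => P.g i j (z.1 i)
  | Sum.inr (Sum.inr j), z => P.g₀ j z.2

/-- The residual `Aᵢₓ x + Aᵢᵧ y + bᵢ` of block `i`. -/
def residual (i : Fin P.I) (x : Vec (P.n i)) (y : Vec P.n₀) : Fin (P.m i) → ℝ :=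
  P.Ax i *ᵥ x.ofLp + P.Ay i *ᵥ y.ofLp + P.b i

/-- All equality constraint functions of the problem. -/
def eqn (l : P.EqIdx) (z : P.Space) : ℝ := P.residual l.1 (z.1 l.1) z.2 l.2

/-- Feasible points of the problem. -/
def IsFeasible (z : P.Space) : Prop := IsFeasiblePoint P.ineq P.eqn P.convexSet z

/-- Stationary points of the problem. -/
def IsStationary (z : P.Space) : Prop :=
  IsStationaryPoint P.objective P.ineq P.eqn P.convexSet z

/-- Every feasible point is regular. -/
def FeasiblePointsRegular : Prop :=
  ∀ z, P.IsFeasible z → IsRegularPoint P.ineq P.eqn P.convexSet z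

/-- The standing assumptions on the problem. -/
structure Assumptions : Prop where
  X_nonempty : ∀ i, (P.X i).Nonempty
  X_closed : ∀ i, IsClosed (P.X i)
  X_convex : ∀ i, Convex ℝ (P.X i)
  U_open : ∀ i, IsOpen (P.U i)
  X_subset : ∀ i, P.X i ⊆ P.U i
  Y_nonempty : P.Y.Nonempty
  Y_closed : IsClosed P.Y
  Y_convex : Convex ℝ P.Y
  V_open : IsOpen P.V
  Y_subset : P.Y ⊆ P.V
  f_contDiff : ∀ i, ContDiffOn ℝ 1 (P.f i) (pairSet (P.U i) P.V)
  f_lipschitz : ∀ i, ∃ L, LipschitzOnWith L (fderiv ℝ (P.f i)) (pairSet (P.X i) P.Y)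
  f₀_contDiff : ContDiffOn ℝ 1 P.f₀ P.V
  f₀_lipschitz : ∃ L, LipschitzOnWith L (fderiv ℝ P.f₀) P.Y
  gc_contDiff : ∀ i j, ContDiffOn ℝ 1 (P.gc i j) (pairSet (P.U i) P.V)
  g_contDiff : ∀ i j, ContDiffOn ℝ 1 (P.g i j) (P.U i)
  g₀_contDiff : ∀ j, ContDiffOn ℝ 1 (P.g₀ j) P.V
  bddBelow : ∃ B : ℝ, ∀ z, P.IsFeasible z → B ≤ P.objective z

/-- Approximate functions for the components of the problem; the last argument is the
point of approximation. -/
structure Approx where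
  F : ∀ i, VecPair (P.n i) P.n₀ → VecPair (P.n i) P.n₀ → ℝ
  F₀ : Vec P.n₀ → Vec P.n₀ → ℝ
  /-- approximations of the coupling inequality constraints `g̃ᵢ` -/
  Gc : ∀ i, Fin (P.rc i) → VecPair (P.n i) P.n₀ → VecPair (P.n i) P.n₀ → ℝ
  G : ∀ i, Fin (P.r i) → Vec (P.n i) → Vec (P.n i) → ℝ
  G₀ : Fin P.r₀ → Vec P.n₀ → Vec P.n₀ → ℝ

namespace Approx

variable {P} (S : P.Approx)

/-- All approximate functions satisfy the surrogate assumptions. -/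
structure IsAdmissible : Prop where
  F : ∀ i, IsObjectiveSurrogate (pairSet (P.U i) P.V) (pairSet (P.X i) P.Y) (P.f i) (S.F i)
  F₀ : IsObjectiveSurrogate P.V P.Y P.f₀ S.F₀
  Gc : ∀ i j, IsConstraintSurrogate (pairSet (P.X i) P.Y) (P.gc i j) (S.Gc i j)
  G : ∀ i j, IsConstraintSurrogate (P.X i) (P.g i j) (S.G i j)
  G₀ : ∀ j, IsConstraintSurrogate P.Y (P.g₀ j) (S.G₀ j)

/-- Feasible set of the `i`-th subproblem at the coupling variable `y`, for the convex
approximate problem built at the current point `zk = (xᵏ, yᵏ)`. -/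
def subFeasible (zk : P.Space) (i : Fin P.I) (y : Vec P.n₀) : Set (Vec (P.n i)) :=
  {x | (∀ j, S.Gc i j (mkPair x y) (mkPair (zk.1 i) zk.2) ≤ 0) ∧
    P.residual i x y = 0 ∧
    (∀ j, S.G i j x (zk.1 i) ≤ 0) ∧
    x ∈ P.X i}

/-- Objective of the `i`-th subproblem at the coupling variable `y`. -/
def subObjective (zk : P.Space) (i : Fin P.I) (y : Vec P.n₀) (x : Vec (P.n i)) : ℝ :=
  S.F i (mkPair x y) (mkPair (zk.1 i) zk.2)

/-- Feasible set of the master problem, including the implicit domain of its objective: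
every subproblem at `y` is feasible. -/
def masterFeasible (zk : P.Space) : Set (Vec P.n₀) :=
  {y | y ∈ P.Y ∧ (∀ j, S.G₀ j y zk.2 ≤ 0) ∧ ∀ i, (S.subFeasible zk i y).Nonempty}

/-- Objective of the master problem, `F₀(y; yᵏ) + ∑ᵢ Fᵢ(xᵢ*(y), y; xᵢᵏ, yᵏ)`, where
`xs y = (x₁*(y), …, x_I*(y))` collects the optimal points of the subproblems. -/
def masterObjective (zk : P.Space) (xs : Vec P.n₀ → P.XSpace) (y : Vec P.n₀) : ℝ :=
  S.F₀ y zk.2 + ∑ i, S.subObjective zk i y (xs y i)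

end Approx

end SPDProblem

/-- `x` is an optimal point of `min φ` over `C`. -/
def IsOptimalOn {E : Type} (φ : E → ℝ) (C : Set E) (x : E) : Prop :=
  x ∈ C ∧ ∀ x' ∈ C, φ x ≤ φ x'

/-- Step sizes in `(0, 1]` that tend to zero and have a divergent sum. -/
structure IsDiminishingStep (γ : ℕ → ℝ) : Prop where
  mem : ∀ k, γ k ∈ Set.Ioc (0 : ℝ) 1
  tendsto_zero : Tendsto γ atTop (𝓝 0)
  sum_diverges : Tendsto (fun N => ∑ k ∈ Finset.range N, γ k) atTop atTop

/-- The sequence `z k = (xᵏ, yᵏ)` is generated by the successive primal decomposition method: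
it starts at a feasible point; at step `k`, `xs k y` collects the optimal points of the
subproblems at each admissible `y`, `ys k` is the optimal point of the master problem, and
the iterate moves from `z k` towards `(xs k (ys k), ys k)` with step size `γ k`. -/
structure IsSPDM (P : SPDProblem) (S : P.Approx) (γ : ℕ → ℝ) (z : ℕ → P.Space)
    (xs : ℕ → Vec P.n₀ → P.XSpace) (ys : ℕ → Vec P.n₀) : Prop where
  step : IsDiminishingStep γ
  init : P.IsFeasible (z 0)
  sub_opt : ∀ k, ∀ y ∈ S.masterFeasible (z k), ∀ i,
    IsOptimalOn (S.subObjective (z k) i y) (S.subFeasible (z k) i y) (xs k y i)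
  master_opt : ∀ k,
    IsOptimalOn (S.masterObjective (z k) (xs k)) (S.masterFeasible (z k)) (ys k)
  update : ∀ k, z (k + 1) = z k + γ k • ((xs k (ys k), ys k) - z k)

end

/-! For fixed `y` the approximate problem splits over the blocks, so minimizing over each `xᵢ` and
then over `y` solves the joint convex approximate problem (`isOptimalOn_of_master`). SPD-M is
therefore successive convex approximation with damped steps, and the argument shows that every limit
point is stationary.

Write `d` for the step from `z` to the surrogate minimizer. Since `z` is feasible for its own
surrogate, strong monotonicity and gradient agreement give `∇f(z)ᵀd ≤ -c‖d‖²`. With the Lipschitz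
gradient, `γₖ → 0` and `f` bounded below, `∑ γₖ‖dₖ‖²` converges. As `∑ γₖ` diverges, there are
iterates arbitrarily close to any cluster point `p` whose `d` is arbitrarily small
(`exists_near_cluster_norm_direction_lt`); along them base points and surrogate minimizers both tend
to `p`.

The approximate problems are not assumed to satisfy a constraint qualification, so each minimizer
gets only a Fritz John multiplier, normalized to norm one. A convergent subsequence yields a nonzero
Fritz John multiplier at `p` (`isStationaryPoint_of_tendsto_minimizers`), and regularity of `p`
alone forces its objective weight to be positive (`isStationaryPoint_of_fritzJohn`). -/

/-! ### Separation and first-order optimality. -/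

/-- `A` need be neither open nor closed. The convex hull of finitely many of its points is compact
and misses 0, hence is strictly separated from it; compactness of the dual unit sphere and the
finite intersection property then give one functional for all of `A`. -/
theorem exists_unit_dual_nonneg_of_convex {W : Type*} [NormedAddCommGroup W] [NormedSpace ℝ W]
    [FiniteDimensional ℝ W] {A : Set W} (hA : Convex ℝ A) (h0 : (0 : W) ∉ A)
    (hne : A.Nonempty) : ∃ l : StrongDual ℝ W, ‖l‖ = 1 ∧ ∀ a ∈ A, 0 ≤ l a := by
  classical
  obtain ⟨a₀, ha₀⟩ := hne
  have hcl : ∀ a : A, IsClosed {l : StrongDual ℝ W | 0 ≤ l a} := fun a =>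
    isClosed_le continuous_const (by fun_prop)
  have key := (isCompact_sphere (0 : StrongDual ℝ W) 1).inter_iInter_nonempty
    (fun a : A => {l : StrongDual ℝ W | 0 ≤ l a}) hcl (by
      intro u
      set T : Set W := insert a₀ ((↑) '' (u : Set A)) with hT
      have hTfin : T.Finite := (u.finite_toSet.image _).insert _
      have hTA : convexHull ℝ T ⊆ A := by
        refine convexHull_min ?_ hA
        rintro x (rfl | ⟨y, -, rfl⟩)
        · exact ha₀
        · exact y.2
      obtain ⟨l, c, hl0, hl⟩ := geometric_hahn_banach_point_closed (convex_convexHull ℝ T)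
        (hTfin.isCompact_convexHull (𝕜 := ℝ)).isClosed (fun h => h0 (hTA h))
      have hpos : ∀ x ∈ T, 0 < l x := fun x hx => by
        have := hl x (subset_convexHull ℝ T hx)
        rw [map_zero] at hl0
        linarith
      have hlne : l ≠ 0 := by
        rintro rfl
        exact lt_irrefl _ (hpos a₀ (Set.mem_insert _ _))
      refine ⟨‖l‖⁻¹ • l, ?_, ?_⟩
      · simp [norm_smul, hlne]
      · simp only [Set.mem_iInter]
        intro a ha
        have := hpos a (Set.mem_insert_of_mem _ ⟨a, ha, rfl⟩)
        change 0 ≤ ‖l‖⁻¹ * l a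
        positivity)
  obtain ⟨l, hl1, hl2⟩ := key
  refine ⟨l, by simpa using hl1, fun a ha => ?_⟩
  exact Set.mem_iInter.1 hl2 ⟨a, ha⟩

theorem HasFDerivAt.nonneg_of_isMinOn_convex {E : Type*} [NormedAddCommGroup E] [NormedSpace ℝ E]
    {f : E → ℝ} {f' : E →L[ℝ] ℝ} {C : Set E} {x₀ : E} (hf : HasFDerivAt f f' x₀)
    (hC : Convex ℝ C) (hx₀ : x₀ ∈ C) (hmin : ∀ x ∈ C, f x₀ ≤ f x) {x : E} (hx : x ∈ C) :
    0 ≤ f' (x - x₀) :=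
  (IsMinOn.localize (f := f) (s := C) (a := x₀) hmin).hasFDerivWithinAt_nonneg
    hf.hasFDerivWithinAt (mem_posTangentConeAt_of_segment_subset (hC.segment_subset hx₀ (by simpa using hx)))

/-! ### Fritz John multipliers, and KKT multipliers at regular points. -/

section Multipliers

variable {E κ η : Type} [NormedAddCommGroup E] [NormedSpace ℝ E] [Fintype κ] [Fintype η]

/-- Fritz John conditions of a convex problem, with a normalized multiplier functional. -/
theorem exists_fritzJohn_multiplier {Z : Set E} (hZ : Convex ℝ Z) (φ : E →L[ℝ] ℝ) {x₀ : E}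
    (hx₀ : x₀ ∈ Z) {G : κ → E → ℝ} (hG : ∀ j, ConvexOn ℝ Z (G j)) {h : η → E → ℝ}
    (hh : ∀ l, ∃ (A : E →L[ℝ] ℝ) (c : ℝ), ∀ z, h l z = A z + c)
    (hopt : ∀ x ∈ Z, (∀ j, G j x ≤ 0) → (∀ l, h l x = 0) → 0 ≤ φ (x - x₀)) :
    ∃ l : StrongDual ℝ (ℝ × (κ → ℝ) × (η → ℝ)), ‖l‖ = 1 ∧
      ∀ x ∈ Z, ∀ s : ℝ, 0 ≤ s → ∀ t : κ → ℝ, 0 ≤ t →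
        0 ≤ l (φ (x - x₀) + s, (fun j => G j x) + t, fun i => h i x) := by
  -- Strictness in the objective coordinate keeps 0 out of `A`. Upward slack in the inequality
  -- coordinates makes `A` convex for merely convex `G`; the equality coordinates need none, being
  -- affine.
  set A : Set (ℝ × (κ → ℝ) × (η → ℝ)) :=
    {w | ∃ x ∈ Z, φ (x - x₀) < w.1 ∧ (∀ j, G j x ≤ w.2.1 j) ∧ ∀ i, h i x = w.2.2 i} with hAdef
  have hA : Convex ℝ A := by
    rintro w ⟨x, hx, h1, h2, h3⟩ w' ⟨x', hx', h1', h2', h3'⟩ a b ha hb hab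
    refine ⟨a • x + b • x', hZ hx hx' ha hb hab, ?_, fun j => ?_, fun i => ?_⟩
    · have : φ (a • x + b • x' - x₀) = a * φ (x - x₀) + b * φ (x' - x₀) := by
        have hb' : b = 1 - a := by linarith
        simp only [map_sub, map_add, map_smul, smul_eq_mul, hb']
        ring
      rw [this]
      change _ < a * w.1 + b * w'.1
      rcases ha.eq_or_lt with rfl | ha
      · have : b = 1 := by linarith
        subst this
        linarith
      · have := mul_lt_mul_of_pos_left h1 ha
        have := mul_le_mul_of_nonneg_left h1'.le hb
        linarith
    · refine ((hG j).2 hx hx' ha hb hab).trans ?_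
      change a * _ + b * _ ≤ a * w.2.1 j + b * w'.2.1 j
      have := mul_le_mul_of_nonneg_left (h2 j) ha
      have := mul_le_mul_of_nonneg_left (h2' j) hb
      linarith
    · obtain ⟨B, c, hB⟩ := hh i
      change _ = a * w.2.2 i + b * w'.2.2 i
      rw [← h3 i, ← h3' i, hB, hB, hB]
      have hb' : b = 1 - a := by linarith
      simp only [map_add, map_smul, smul_eq_mul, hb']
      ring
  have h0 : (0 : ℝ × (κ → ℝ) × (η → ℝ)) ∉ A := by
    rintro ⟨x, hx, h1, h2, h3⟩
    exact absurd (hopt x hx h2 h3) (not_le.2 h1)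
  have hne : A.Nonempty := ⟨(1, fun j => G j x₀, fun i => h i x₀), x₀, hx₀, by simp, by simp, by simp⟩
  obtain ⟨l, hl1, hl2⟩ := exists_unit_dual_nonneg_of_convex hA h0 hne
  refine ⟨l, hl1, fun x hx s hs t ht => ?_⟩
  -- The strict slack defining `A` is relaxed to `s ≥ 0` by letting `ε ↓ 0`.
  have hT : Tendsto (fun ε : ℝ => l (φ (x - x₀) + s + ε, (fun j => G j x) + t, fun i => h i x))
      (𝓝[>] 0) (𝓝 (l (φ (x - x₀) + s + 0, (fun j => G j x) + t, fun i => h i x))) := by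
    refine (Continuous.tendsto ?_ _).mono_left nhdsWithin_le_nhds
    fun_prop
  rw [add_zero] at hT
  refine ge_of_tendsto hT ?_
  filter_upwards [self_mem_nhdsWithin] with ε hε
  have hε' : (0 : ℝ) < ε := hε
  refine hl2 _ ⟨x, hx, ?_, fun j => ?_, fun i => rfl⟩
  · change _ < φ (x - x₀) + s + ε
    linarith
  · have := ht j
    simpa using this

/-- The coordinates of `l` are the objective weight and the two families of multipliers; keeping
them in one functional lets a single norm normalize them all. -/
theorem dual_prod_pi_apply [DecidableEq κ] [DecidableEq η]
    (l : StrongDual ℝ (ℝ × (κ → ℝ) × (η → ℝ))) (a : ℝ) (b : κ → ℝ) (c : η → ℝ) :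
    l (a, b, c) = l (1, 0, 0) * a + ∑ j, l (0, Pi.single j 1, 0) * b j
      + ∑ i, l (0, 0, Pi.single i 1) * c i := by
  have h1 : ((a, b, c) : ℝ × (κ → ℝ) × (η → ℝ)) = a • ((1 : ℝ), (0 : κ → ℝ), (0 : η → ℝ))
      + ∑ j, b j • ((0 : ℝ), (Pi.single j 1 : κ → ℝ), (0 : η → ℝ))
      + ∑ i, c i • ((0 : ℝ), (0 : κ → ℝ), (Pi.single i 1 : η → ℝ)) := by
    refine Prod.ext ?_ (Prod.ext ?_ ?_)
    · simp [Prod.fst_sum]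
    · ext j
      simp [Prod.fst_sum, Prod.snd_sum, Finset.sum_apply, Pi.single_apply]
    · ext j
      simp [Prod.snd_sum, Finset.sum_apply, Pi.single_apply]
  rw [h1]
  simp only [map_add, map_sum, map_smul, smul_eq_mul]
  simp only [mul_comm]

/-- A functional satisfying the Fritz John inequalities at a regular point yields a
stationary point. -/
theorem isStationaryPoint_of_fritzJohn {Z : Set E} (hZ : Convex ℝ Z) {f : E → ℝ}
    {g G : κ → E → ℝ} {h : η → E → ℝ} {p : E} (hp : IsFeasiblePoint g h Z p)
    (hreg : IsRegularPoint g h Z p)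
    (hGval : ∀ j, G j p = g j p) (hGdiff : ∀ j, HasFDerivAt (G j) (fderiv ℝ (g j) p) p)
    (hh : ∀ i, DifferentiableAt ℝ (h i) p)
    (l : StrongDual ℝ (ℝ × (κ → ℝ) × (η → ℝ))) (hl : l ≠ 0)
    (hFJ : ∀ x ∈ Z, ∀ s : ℝ, 0 ≤ s → ∀ t : κ → ℝ, 0 ≤ t →
        0 ≤ l (fderiv ℝ f p (x - p) + s, (fun j => G j x) + t, fun i => h i x)) :
    IsStationaryPoint f g h Z p := by
  classical
  obtain ⟨hp1, hp2, hp3⟩ := hp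
  set μ₀ := l (1, 0, 0) with hμ₀
  set μ : κ → ℝ := fun j => l (0, Pi.single j 1, 0) with hμ
  set lam : η → ℝ := fun i => l (0, 0, Pi.single i 1) with hlam
  have hdec : ∀ a b c, l (a, b, c) = μ₀ * a + ∑ j, μ j * b j + ∑ i, lam i * c i :=
    dual_prod_pi_apply l
  -- At `x = p` only the slack is left; it yields both the signs and complementarity.
  have hcone : ∀ s : ℝ, 0 ≤ s → ∀ t : κ → ℝ, (∀ j, g j p ≤ t j) → 0 ≤ l (s, t, 0) := by
    intro s hs t ht
    have := hFJ p hp3 s hs (t - fun j => g j p) (fun j => by simpa using ht j)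
    simpa [hGval, hp2, ← Pi.zero_def] using this
  have hμ₀0 : 0 ≤ μ₀ := hcone 1 zero_le_one 0 (by simpa using hp1)
  have hμ0 : ∀ j, 0 ≤ μ j := fun j => hcone 0 le_rfl _ (fun i => by
    refine (hp1 i).trans ?_
    by_cases hij : i = j
    · subst hij; simp
    · simp [hij])
  have hcomp : ∀ j, μ j * g j p = 0 := by
    intro j
    refine le_antisymm (mul_nonpos_of_nonneg_of_nonpos (hμ0 j) (hp1 j)) ?_
    have h1 := hcone 0 le_rfl (Pi.single j (g j p)) (fun i => by
      by_cases hij : i = j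
      · subst hij; simp
      · simpa [hij] using hp1 i)
    rw [hdec] at h1
    simpa [Pi.single_apply] using h1
  have hvar : ∀ x ∈ Z, 0 ≤ (μ₀ • fderiv ℝ f p + ∑ j, μ j • fderiv ℝ (g j) p
      + ∑ i, lam i • fderiv ℝ (h i) p) (x - p) := by
    intro x hx
    -- This Lagrangian, with linearized objective, vanishes at `p` by complementarity and is
    -- nonnegative on `Z`, so `p` minimizes it there.
    have hder : HasFDerivAt (fun x => μ₀ * (fderiv ℝ f p (x - p)) + ∑ j, μ j * G j x
        + ∑ i, lam i * h i x) (μ₀ • fderiv ℝ f p + ∑ j, μ j • fderiv ℝ (g j) p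
      + ∑ i, lam i • fderiv ℝ (h i) p) p := by
      refine (HasFDerivAt.add (HasFDerivAt.const_mul ?_ _)
        (HasFDerivAt.fun_sum fun j _ => (hGdiff j).const_mul _)).add
        (HasFDerivAt.fun_sum fun i _ => (hh i).hasFDerivAt.const_mul _)
      have := (fderiv ℝ f p).hasFDerivAt.comp p ((hasFDerivAt_id p).sub_const p)
      rwa [ContinuousLinearMap.comp_id] at this
    refine hder.nonneg_of_isMinOn_convex hZ hp3 (fun y hy => ?_) hx
    have h1 := hFJ y hy 0 le_rfl 0 le_rfl
    rw [add_zero, add_zero, hdec] at h1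
    simpa [hGval, hp2, hcomp] using h1
  have hμ₀ne : μ₀ ≠ 0 := by
    intro h0
    obtain ⟨e1, e2⟩ := hreg μ lam (by simpa [h0] using hvar) hμ0 (fun j hj => by
      simpa [hj] using hcomp j)
    apply hl
    ext w
    · simp [hdec, h0]
    · simp [hdec, h0, e1, e2]
    · simp [hdec, h0, e1, e2]
  have hpos : 0 < μ₀ := lt_of_le_of_ne hμ₀0 (Ne.symm hμ₀ne)
  refine ⟨μ₀⁻¹ • μ, μ₀⁻¹ • lam, fun x hx => ?_, fun j => ?_, fun j => ?_, hp1, hp2, hp3⟩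
  · have h1 := mul_nonneg (inv_nonneg.2 hμ₀0) (hvar x hx)
    have e : fderiv ℝ f p + ∑ j, (μ₀⁻¹ • μ) j • fderiv ℝ (g j) p
        + ∑ i, (μ₀⁻¹ • lam) i • fderiv ℝ (h i) p = μ₀⁻¹ • (μ₀ • fderiv ℝ f p
        + ∑ j, μ j • fderiv ℝ (g j) p + ∑ i, lam i • fderiv ℝ (h i) p) := by
      simp only [smul_add, Finset.smul_sum, smul_smul, inv_mul_cancel₀ hμ₀ne, one_smul,
        Pi.smul_apply, smul_eq_mul]
    rw [e]
    exact h1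
  · simp [mul_assoc, hcomp]
  · exact mul_nonneg (inv_nonneg.2 hμ₀0) (hμ0 j)

end Multipliers

/-! ### Estimates for the recursion and for the objective. -/

/-- If `∑ γ ‖d‖²` converges while `∑ γ` diverges, then the directions `d` are not bounded away
from zero near a cluster point of the recursion `z ↦ z + γ d`. -/
theorem exists_near_cluster_norm_direction_lt {E : Type*} [NormedAddCommGroup E] [NormedSpace ℝ E]
    {γ : ℕ → ℝ} (hγ : ∀ k, 0 ≤ γ k)
    (hdiv : Tendsto (fun N => ∑ k ∈ Finset.range N, γ k) atTop atTop)
    {z d : ℕ → E} (hz : ∀ k, z (k + 1) = z k + γ k • d k)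
    (hsum : Summable fun k => γ k * ‖d k‖ ^ 2) {p : E} (hp : MapClusterPt p atTop z)
    {ε : ℝ} (hε : 0 < ε) : ∃ k, ‖z k - p‖ < ε ∧ ‖d k‖ < ε := by
  by_contra! hcon
  have hε2 : 0 < ε / 2 := by linarith
  have hterm : ∀ k, 0 ≤ γ k * ‖d k‖ ^ 2 := fun k => mul_nonneg (hγ k) (by positivity)
  have htail := tendsto_sum_nat_add fun k => γ k * ‖d k‖ ^ 2
  -- Where `‖d‖ ≥ ε`, a step has length at most `ε⁻¹ γ‖d‖²`. This tail thus bounds the path by `ε /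
  -- 2`; the other half is the starting distance, so the iterates stay trapped in the ball.
  have hev : ∀ᶠ m in atTop, ∑' k, γ (k + m) * ‖d (k + m)‖ ^ 2 < ε * (ε / 2) :=
    htail.eventually (gt_mem_nhds (by positivity))
  have hfr : ∃ᶠ m in atTop, z m ∈ Metric.ball p (ε / 2) :=
    hp.frequently (Metric.ball_mem_nhds p hε2)
  obtain ⟨m, hm1, hm2⟩ := (hfr.and_eventually hev).exists
  rw [mem_ball_iff_norm] at hm1
  have hsum' : Summable fun k => γ (k + m) * ‖d (k + m)‖ ^ 2 :=
    (summable_nat_add_iff (f := fun k => γ k * ‖d k‖ ^ 2) m).2 hsum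
  have hpart : ∀ n, ∑ k ∈ Finset.range n, γ (k + m) * ‖d (k + m)‖ ^ 2 < ε * (ε / 2) := fun n =>
    (hsum'.sum_le_tsum _ fun k _ => hterm _).trans_lt hm2
  have hind : ∀ n, ‖z (n + m) - p‖ ≤ ‖z m - p‖
      + ε⁻¹ * ∑ k ∈ Finset.range n, γ (k + m) * ‖d (k + m)‖ ^ 2 := by
    have hlt : ∀ n, ε⁻¹ * ∑ k ∈ Finset.range n, γ (k + m) * ‖d (k + m)‖ ^ 2 < ε / 2 := fun n => by
      rw [inv_mul_lt_iff₀ hε]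
      exact hpart n
    intro n
    induction n with
    | zero => simp
    | succ n ih =>
      have hd := hcon (n + m) (by linarith [hlt n])
      have e : z (n + 1 + m) - p = (z (n + m) - p) + γ (n + m) • d (n + m) := by
        rw [add_right_comm, hz]
        abel
      have hstep : ‖γ (n + m) • d (n + m)‖ ≤ ε⁻¹ * (γ (n + m) * ‖d (n + m)‖ ^ 2) := by
        rw [norm_smul, Real.norm_of_nonneg (hγ _), le_inv_mul_iff₀ hε]
        have := mul_le_mul_of_nonneg_left hd (mul_nonneg (hγ (n + m)) (norm_nonneg (d (n + m))))
        linarith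
      rw [e, Finset.sum_range_succ, mul_add]
      linarith [norm_add_le (z (n + m) - p) (γ (n + m) • d (n + m))]
  have hfar : ∀ n, ε ≤ ‖d (n + m)‖ := fun n => hcon _ (by
    have h1 : ε⁻¹ * ∑ k ∈ Finset.range n, γ (k + m) * ‖d (k + m)‖ ^ 2 < ε / 2 := by
      rw [inv_mul_lt_iff₀ hε]
      exact hpart n
    linarith [hind n])
  -- Trapped forever, the iterates have `‖d‖ ≥ ε` from `m` on, so `γ ≤ ε⁻² γ‖d‖²`.
  have hγsum : Summable γ := by
    rw [← summable_nat_add_iff m]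
    refine Summable.of_nonneg_of_le (fun k => hγ _) (fun k => ?_) (hsum'.mul_left (ε ^ 2)⁻¹)
    rw [le_inv_mul_iff₀ (by positivity), mul_comm]
    have := hfar k
    have := hγ (k + m)
    gcongr
  exact not_tendsto_atTop_of_tendsto_nhds hγsum.hasSum.tendsto_sum_nat hdiv

/-- Quadratic upper bound of a function with Lipschitz derivative on a convex set. -/
theorem LipschitzOnWith.le_add_fderiv_add_sq {E : Type*} [NormedAddCommGroup E] [NormedSpace ℝ E]
    {f : E → ℝ} {Z : Set E} (hZ : Convex ℝ Z) {K : NNReal} (hf : ∀ x ∈ Z, DifferentiableAt ℝ f x)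
    (hK : LipschitzOnWith K (fderiv ℝ f) Z) {x y : E} (hx : x ∈ Z) (hy : y ∈ Z) :
    f y ≤ f x + fderiv ℝ f x (y - x) + K * ‖y - x‖ ^ 2 := by
  have hseg := hZ.segment_subset hx hy
  -- On the segment the derivative is within `K‖y - x‖` of its value at `x`. The mean value
  -- inequality gives the constant `K`; the sharper `K / 2` is not needed.
  have h := (convex_segment x y).norm_image_sub_le_of_norm_fderiv_le' (𝕜 := ℝ) (f := f)
    (φ := fderiv ℝ f x) (C := K * ‖y - x‖) (fun w hw => hf w (hseg hw)) (fun w hw => ?_)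
    (left_mem_segment ℝ x y) (right_mem_segment ℝ x y)
  · rw [Real.norm_eq_abs] at h
    have := (abs_le.1 h).2
    nlinarith
  · refine (hK.norm_sub_le (hseg hw) hx).trans ?_
    gcongr
    obtain ⟨t, ⟨ht0, ht1⟩, rfl⟩ := (segment_eq_image' ℝ x y ▸ hw : w ∈ _)
    rw [add_sub_cancel_left, norm_smul, Real.norm_of_nonneg ht0]
    exact mul_le_of_le_one_left (norm_nonneg _) ht1

/-! ### Convergence of successive convex approximation. -/

section Convergence

variable {E κ η : Type} [NormedAddCommGroup E] [NormedSpace ℝ E]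

/-- Feasible set of the convex approximate problem built at `w`. -/
def surrogateFeasible (G : κ → E → E → ℝ) (h : η → E → ℝ) (Z : Set E) (w : E) : Set E :=
  {x | IsFeasiblePoint (fun j x => G j x w) h Z x}

variable {U Z : Set E} {f : E → ℝ} {F : E → E → ℝ} {g : κ → E → ℝ} {G : κ → E → E → ℝ}
  {h : η → E → ℝ}

theorem convex_surrogateFeasible (hZ : Convex ℝ Z)
    (hG : ∀ j, IsConstraintSurrogate Z (g j) (G j))
    (hh : ∀ l, ∃ (A : E →L[ℝ] ℝ) (c : ℝ), ∀ z, h l z = A z + c) {w : E} (hw : w ∈ Z) :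
    Convex ℝ (surrogateFeasible G h Z w) := by
  rintro x ⟨h1, h2, h3⟩ y ⟨h1', h2', h3'⟩ a b ha hb hab
  refine ⟨fun j => ?_, fun l => ?_, hZ h3 h3' ha hb hab⟩
  · refine (((hG j).convex w hw).2 h3 h3' ha hb hab).trans ?_
    have := mul_nonpos_of_nonneg_of_nonpos ha (h1 j)
    have := mul_nonpos_of_nonneg_of_nonpos hb (h1' j)
    simp only [smul_eq_mul]
    linarith
  · obtain ⟨A, c, hA⟩ := hh l
    have e1 := h2 l
    have e2 := h2' l
    rw [hA] at e1 e2 ⊢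
    simp only [map_add, map_smul, smul_eq_mul]
    linear_combination a * e1 + b * e2 - c * hab

theorem mem_surrogateFeasible_self (hG : ∀ j, IsConstraintSurrogate Z (g j) (G j)) {w : E}
    (hw : IsFeasiblePoint g h Z w) : w ∈ surrogateFeasible G h Z w :=
  ⟨fun j => ((hG j).value_eq w hw.2.2).trans_le (hw.1 j), hw.2⟩

/-- Majorization makes the surrogate set an inner approximation of the true feasible set; this is
what keeps all iterates feasible. -/
theorem isFeasiblePoint_of_mem_surrogateFeasible (hG : ∀ j, IsConstraintSurrogate Z (g j) (G j))
    {w x : E} (hw : w ∈ Z) (hx : x ∈ surrogateFeasible G h Z w) : IsFeasiblePoint g h Z x :=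
  ⟨fun j => by linarith [(hG j).majorizes x hx.2.2 w hw, show G j x w ≤ 0 from hx.1 j], hx.2⟩

theorem IsObjectiveSurrogate.differentiableAt (hF : IsObjectiveSurrogate U Z f F) (hU : IsOpen U)
    {w x : E} (hw : w ∈ Z) (hx : x ∈ U) : DifferentiableAt ℝ (fun v => F v w) x :=
  ((hF.contDiff w hw).contDiffAt (hU.mem_nhds hx)).differentiableAt one_ne_zero

/-- Replaces the surrogate objective by its linearization at the minimizer, the form that
`exists_fritzJohn_multiplier` takes. -/
theorem IsObjectiveSurrogate.first_order (hF : IsObjectiveSurrogate U Z f F) (hU : IsOpen U)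
    (hZU : Z ⊆ U) (hZ : Convex ℝ Z) (hG : ∀ j, IsConstraintSurrogate Z (g j) (G j))
    (hh : ∀ l, ∃ (A : E →L[ℝ] ℝ) (c : ℝ), ∀ z, h l z = A z + c) {w x₀ x : E} (hw : w ∈ Z)
    (hopt : IsOptimalOn (fun x => F x w) (surrogateFeasible G h Z w) x₀)
    (hx : x ∈ surrogateFeasible G h Z w) :
    0 ≤ fderiv ℝ (fun v => F v w) x₀ (x - x₀) :=
  (hF.differentiableAt hU hw (hZU hopt.1.2.2)).hasFDerivAt.nonneg_of_isMinOn_convex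
    (convex_surrogateFeasible hZ hG hh hw) hopt.1 hopt.2 hx

/-- The minimizer of the approximate problem provides a descent direction. -/
theorem IsObjectiveSurrogate.descent_direction (hF : IsObjectiveSurrogate U Z f F) (hU : IsOpen U)
    (hZU : Z ⊆ U) (hZ : Convex ℝ Z) (hG : ∀ j, IsConstraintSurrogate Z (g j) (G j))
    (hh : ∀ l, ∃ (A : E →L[ℝ] ℝ) (c : ℝ), ∀ z, h l z = A z + c) :
    ∃ c : ℝ, 0 < c ∧ ∀ w x₀, IsFeasiblePoint g h Z w →
      IsOptimalOn (fun x => F x w) (surrogateFeasible G h Z w) x₀ →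
      fderiv ℝ f w (x₀ - w) ≤ -c * ‖x₀ - w‖ ^ 2 := by
  obtain ⟨c, hc, hmono⟩ := hF.stronglyConvex
  refine ⟨c, hc, fun w x₀ hw hopt => ?_⟩
  have hwZ := hw.2.2
  -- The variational inequality is tested at the base point `w`, then compared with strong
  -- monotonicity between `x₀` and `w`, where the surrogate gradient is that of `f`.
  have h1 := hF.first_order hU hZU hZ hG hh hwZ hopt (mem_surrogateFeasible_self hG hw)
  have h2 := hmono w hwZ x₀ hopt.1.2.2 w hwZ
  rw [hF.grad_eq w hwZ, sub_apply] at h2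
  rw [← neg_sub, map_neg] at h1
  linarith

variable [Fintype κ] [Fintype η]

/-- Limits of minimizers of the approximate problems that agree with the limit of the base points
are stationary. -/
theorem isStationaryPoint_of_tendsto_minimizers (hU : IsOpen U) (hZU : Z ⊆ U) (hZ : Convex ℝ Z)
    (hF : IsObjectiveSurrogate U Z f F) (hG : ∀ j, IsConstraintSurrogate Z (g j) (G j))
    (hh : ∀ l, ∃ (A : E →L[ℝ] ℝ) (c : ℝ), ∀ z, h l z = A z + c) {p : E}
    (hp : IsFeasiblePoint g h Z p) (hreg : IsRegularPoint g h Z p) {w x₀ : ℕ → E}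
    (hw : ∀ k, w k ∈ Z)
    (hopt : ∀ k, IsOptimalOn (fun x => F x (w k)) (surrogateFeasible G h Z (w k)) (x₀ k))
    (hwp : Tendsto w atTop (𝓝 p)) (hxp : Tendsto x₀ atTop (𝓝 p)) :
    IsStationaryPoint f g h Z p := by
  have hpZ := hp.2.2
  have hx₀ : ∀ k, x₀ k ∈ Z := fun k => (hopt k).1.2.2
  choose l hl1 hl2 using fun k => exists_fritzJohn_multiplier hZ
    (fderiv ℝ (fun v => F v (w k)) (x₀ k)) (hx₀ k)
    (fun j => (hG j).convex (w k) (hw k)) hh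
    (fun x hx h1 h2 => hF.first_order hU hZU hZ hG hh (hw k) (hopt k) ⟨h1, h2, hx⟩)
  obtain ⟨m, hm, s, hs, hlm⟩ :=
    (isCompact_sphere (0 : StrongDual ℝ (ℝ × (κ → ℝ) × (η → ℝ))) 1).tendsto_subseq
      (x := l) (fun k => by simpa using hl1 k)
  have hsw := hwp.comp hs.tendsto_atTop
  have hsx := hxp.comp hs.tendsto_atTop
  have hgrad : Tendsto (fun k => fderiv ℝ (fun v => F v (w (s k))) (x₀ (s k))) atTop
      (𝓝 (fderiv ℝ f p)) := by
    rw [← hF.grad_eq p hpZ]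
    refine ((hF.grad_continuous (p, p) ⟨hZU hpZ, hpZ⟩).tendsto).comp
      (f := fun k => (x₀ (s k), w (s k))) (tendsto_nhdsWithin_iff.2 ⟨hsx.prodMk_nhds hsw, ?_⟩)
    exact Eventually.of_forall fun k => ⟨hZU (hx₀ _), hw _⟩
  refine isStationaryPoint_of_fritzJohn hZ hp hreg (fun j => (hG j).value_eq p hpZ)
    (G := fun j x => G j x p) (fun j => ?_) (fun i => ?_) m (fun h0 => by simp [h0] at hm)
    (fun x hx a ha t ht => ?_)
  · rw [← (hG j).grad_eq p hpZ]
    exact ((hG j).differentiable p hpZ p hpZ).hasFDerivAt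
  · obtain ⟨A, c, hA⟩ := hh i
    rw [show h i = fun z => A z + c from funext hA]
    fun_prop
  · have hGlim : ∀ j, Tendsto (fun k => G j x (w (s k))) atTop (𝓝 (G j x p)) := fun j =>
      (((hG j).continuous (x, p) ⟨hx, hpZ⟩).tendsto).comp (f := fun k => (x, w (s k)))
        (tendsto_nhdsWithin_iff.2 ⟨tendsto_const_nhds.prodMk_nhds hsw,
          Eventually.of_forall fun k => ⟨hx, hw _⟩⟩)
    replace hlm : Tendsto (fun k => l (s k)) atTop (𝓝 m) := hlm
    have happ : ∀ {V : Type} [NormedAddCommGroup V] [NormedSpace ℝ V] {A : ℕ → V →L[ℝ] ℝ}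
        {A₀ : V →L[ℝ] ℝ} {v : ℕ → V} {v₀ : V}, Tendsto A atTop (𝓝 A₀) → Tendsto v atTop (𝓝 v₀) →
        Tendsto (fun k => A k (v k)) atTop (𝓝 (A₀ v₀)) := fun hA hv =>
      (isBoundedBilinearMap_apply.continuous.tendsto _).comp (hA.prodMk_nhds hv)
    -- The test point `x` ranges over all of `Z`, not over the moving surrogate sets, so it can stay
    -- fixed in the limit.
    refine ge_of_tendsto' (happ hlm (((happ hgrad
      (tendsto_const_nhds.sub hsx)).add_const a).prodMk_nhds
        (((tendsto_pi_nhds.2 hGlim).add_const t).prodMk_nhds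
          (tendsto_const_nhds (x := fun i => h i x))))) fun k => ?_
    exact hl2 (s k) x hx a ha t ht

/-- Convergence of the successive convex approximation method with diminishing steps: every
cluster point of the iterates is stationary. -/
theorem isStationaryPoint_of_mapClusterPt (hU : IsOpen U) (hZU : Z ⊆ U) (hZ : Convex ℝ Z)
    (hZc : IsClosed Z) (hF : IsObjectiveSurrogate U Z f F)
    (hG : ∀ j, IsConstraintSurrogate Z (g j) (G j))
    (hg : ∀ j, ∀ x ∈ Z, ContinuousAt (g j) x)
    (hh : ∀ l, ∃ (A : E →L[ℝ] ℝ) (c : ℝ), ∀ z, h l z = A z + c)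
    {K : ℝ} (hK : ∀ x ∈ Z, ∀ y ∈ Z, f y ≤ f x + fderiv ℝ f x (y - x) + K * ‖y - x‖ ^ 2)
    {B : ℝ} (hB : ∀ x, IsFeasiblePoint g h Z x → B ≤ f x)
    (hreg : ∀ x, IsFeasiblePoint g h Z x → IsRegularPoint g h Z x)
    {γ : ℕ → ℝ} (hγ : IsDiminishingStep γ) {z zh : ℕ → E} (h0 : IsFeasiblePoint g h Z (z 0))
    (hopt : ∀ k, IsOptimalOn (fun x => F x (z k)) (surrogateFeasible G h Z (z k)) (zh k))
    (hz : ∀ k, z (k + 1) = z k + γ k • (zh k - z k))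
    {p : E} (hp : MapClusterPt p atTop z) : IsStationaryPoint f g h Z p := by
  have hfeas : ∀ k, IsFeasiblePoint g h Z (z k) := by
    intro k
    induction k with
    | zero => exact h0
    | succ k ih =>
      refine isFeasiblePoint_of_mem_surrogateFeasible hG ih.2.2 ?_
      rw [hz]
      exact (convex_surrogateFeasible hZ hG hh ih.2.2).add_smul_sub_mem
        (mem_surrogateFeasible_self hG ih) (hopt k).1 ⟨(hγ.mem k).1.le, (hγ.mem k).2⟩
  have hzZ : ∀ k, z k ∈ Z := fun k => (hfeas k).2.2
  obtain ⟨c, hc, hdesc⟩ := hF.descent_direction hU hZU hZ hG hh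
  have hstep : ∀ k, f (z (k + 1)) ≤ f (z k) - γ k * (c - K * γ k) * ‖zh k - z k‖ ^ 2 := by
    intro k
    have h1 := hK _ (hzZ k) _ (hzZ (k + 1))
    have h2 := mul_le_mul_of_nonneg_left (hdesc _ _ (hfeas k) (hopt k)) (hγ.mem k).1.le
    rw [hz k, add_sub_cancel_left, map_smul, smul_eq_mul, norm_smul,
      Real.norm_of_nonneg (hγ.mem k).1.le] at h1
    rw [hz k]
    nlinarith
  -- From here on half of the descent constant survives the second-order term, and `hstep`
  -- telescopes.
  have hKγ : ∀ᶠ k in atTop, K * γ k < c / 2 := by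
    have : Tendsto (fun k => K * γ k) atTop (𝓝 (K * 0)) := hγ.tendsto_zero.const_mul K
    rw [mul_zero] at this
    exact this.eventually (gt_mem_nhds (by linarith))
  obtain ⟨N, hN⟩ := eventually_atTop.1 hKγ
  have hnn : ∀ k, 0 ≤ γ k * ‖zh k - z k‖ ^ 2 := fun k =>
    mul_nonneg (hγ.mem k).1.le (by positivity)
  have hsum : Summable fun k => γ k * ‖zh k - z k‖ ^ 2 := by
    rw [← summable_nat_add_iff N]
    refine summable_of_sum_range_le (c := (c / 2)⁻¹ * (f (z N) - B)) (fun k => hnn _) fun n => ?_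
    rw [le_inv_mul_iff₀ (by linarith)]
    have hind : ∀ n, c / 2 * ∑ i ∈ Finset.range n, γ (i + N) * ‖zh (i + N) - z (i + N)‖ ^ 2
        ≤ f (z N) - f (z (n + N)) := by
      intro n
      induction n with
      | zero => simp
      | succ n ih =>
        have h1 := hstep (n + N)
        have h2 := mul_le_mul_of_nonneg_right (hN (n + N) (by omega)).le (hnn (n + N))
        rw [Finset.sum_range_succ, mul_add, add_right_comm]
        linarith
    linarith [hind n, hB _ (hfeas (n + N))]
  have hpZ : p ∈ Z := by
    by_contra hcon
    obtain ⟨k, hk⟩ := (hp.frequently (hZc.isOpen_compl.mem_nhds hcon)).exists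
    exact hk (hzZ k)
  -- The indices `s n` need not increase: `isStationaryPoint_of_tendsto_minimizers` only asks that
  -- base points and minimizers converge to `p`.
  choose s hs1 hs2 using fun n : ℕ => exists_near_cluster_norm_direction_lt
    (fun k => (hγ.mem k).1.le) hγ.sum_diverges hz hsum hp
    (Nat.one_div_pos_of_nat (α := ℝ) (n := n))
  have hwp : Tendsto (fun n => z (s n)) atTop (𝓝 p) :=
    tendsto_iff_norm_sub_tendsto_zero.2 (squeeze_zero (fun _ => norm_nonneg _)
      (fun n => (hs1 n).le) tendsto_one_div_add_atTop_nhds_zero_nat)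
  have hdp : Tendsto (fun n => zh (s n) - z (s n)) atTop (𝓝 0) :=
    squeeze_zero_norm (fun n => (hs2 n).le) tendsto_one_div_add_atTop_nhds_zero_nat
  have hxp : Tendsto (fun n => zh (s n)) atTop (𝓝 p) := by
    simpa using hwp.add hdp
  have hpf : IsFeasiblePoint g h Z p := by
    refine ⟨fun j => ?_, fun l => ?_, hpZ⟩
    · exact le_of_tendsto' ((hg j p hpZ).tendsto.comp hwp) fun n => (hfeas (s n)).1 j
    · obtain ⟨A, d, hA⟩ := hh l
      have hcont : Continuous (h l) := by
        rw [show h l = fun z => A z + d from funext hA]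
        fun_prop
      refine tendsto_nhds_unique ((hcont.tendsto p).comp hwp) ?_
      exact tendsto_const_nhds.congr fun n => ((hfeas (s n)).2.1 l).symm
  exact isStationaryPoint_of_tendsto_minimizers hU hZU hZ hF hG hh hpf (hreg p hpf)
    (fun n => hzZ (s n)) (fun n => hopt (s n)) hwp hxp

end Convergence

/-! ### Transfer of surrogates and bounds from blocks to the joint space. -/

section Pullback

variable {E E' : Type} [NormedAddCommGroup E] [NormedSpace ℝ E] [NormedAddCommGroup E']
  [NormedSpace ℝ E']

theorem IsConstraintSurrogate.comp_continuousLinearMap {X : Set E} {X' : Set E'} {g : E' → ℝ}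
    {G : E' → E' → ℝ} (hG : IsConstraintSurrogate X' g G) (L : E →L[ℝ] E') (hX : Convex ℝ X)
    (hL : ∀ x ∈ X, L x ∈ X') (hg : ∀ x ∈ X', DifferentiableAt ℝ g x) :
    IsConstraintSurrogate X (fun x => g (L x)) (fun x z => G (L x) (L z)) := by
  have hfd : ∀ x ∈ X, ∀ z ∈ X, HasFDerivAt (fun w => G (L w) (L z))
      ((fderiv ℝ (fun w => G w (L z)) (L x)).comp L) x := fun x hx z hz =>
    (hG.differentiable (L x) (hL x hx) (L z) (hL z hz)).hasFDerivAt.comp x L.hasFDerivAt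
  refine ⟨fun z hz => ⟨hX, ?_⟩, fun z hz => hG.value_eq _ (hL z hz),
    fun x hx z hz => hG.majorizes _ (hL x hx) _ (hL z hz), ?_,
    fun x hx z hz => (hfd x hx z hz).differentiableAt, fun z hz => ?_, ?_⟩
  · intro x hx y hy a b ha hb hab
    simpa using (hG.convex (L z) (hL z hz)).2 (hL x hx) (hL y hy) ha hb hab
  · exact hG.continuous.comp (f := fun p : E × E => (L p.1, L p.2)) (by fun_prop)
      fun p hp => ⟨hL _ hp.1, hL _ hp.2⟩
  · rw [(hfd z hz z hz).fderiv, hG.grad_eq _ (hL z hz)]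
    exact ((hg _ (hL z hz)).hasFDerivAt.comp z L.hasFDerivAt).fderiv.symm
  · have h1 : ContinuousOn (fun p : E × E =>
        (fderiv ℝ (fun w => G w (L p.2)) (L p.1)).comp L) (X ×ˢ X) := by
      refine ContinuousOn.clm_comp ?_ continuousOn_const
      exact hG.grad_continuous.comp (f := fun p : E × E => (L p.1, L p.2)) (by fun_prop)
        fun p hp => ⟨hL _ hp.1, hL _ hp.2⟩
    exact h1.congr fun p hp => (hfd p.1 hp.1 p.2 hp.2).fderiv

/-- Sums of pullbacks of objective surrogates, when the linear maps together control the norm. -/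
theorem IsObjectiveSurrogate.add_sum {ι : Type} [Fintype ι] {D : ι → Type}
    [∀ i, NormedAddCommGroup (D i)] [∀ i, NormedSpace ℝ (D i)] {U X : Set E}
    (hXU : X ⊆ U)
    {U₀ X₀ : Set E'} {f₀ : E' → ℝ} {F₀ : E' → E' → ℝ} (hF₀ : IsObjectiveSurrogate U₀ X₀ f₀ F₀)
    (hU₀ : IsOpen U₀) (hf₀ : ∀ x ∈ U₀, DifferentiableAt ℝ f₀ x)
    {U' X' : ∀ i, Set (D i)} {f : ∀ i, D i → ℝ} {F : ∀ i, D i → D i → ℝ}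
    (hF : ∀ i, IsObjectiveSurrogate (U' i) (X' i) (f i) (F i)) (hU' : ∀ i, IsOpen (U' i))
    (hf : ∀ i, ∀ x ∈ U' i, DifferentiableAt ℝ (f i) x)
    (L₀ : E →L[ℝ] E') (L : ∀ i, E →L[ℝ] D i) (hLU₀ : ∀ x ∈ U, L₀ x ∈ U₀)
    (hLX₀ : ∀ x ∈ X, L₀ x ∈ X₀) (hLU : ∀ i, ∀ x ∈ U, L i x ∈ U' i)
    (hLX : ∀ i, ∀ x ∈ X, L i x ∈ X' i)
    (hnorm : ∀ x, ‖x‖ ^ 2 ≤ ‖L₀ x‖ ^ 2 + ∑ i, ‖L i x‖ ^ 2) :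
    IsObjectiveSurrogate U X (fun x => f₀ (L₀ x) + ∑ i, f i (L i x))
      (fun x z => F₀ (L₀ x) (L₀ z) + ∑ i, F i (L i x) (L i z)) := by
  have hfd : ∀ x ∈ U, ∀ z ∈ X, HasFDerivAt (fun w => F₀ (L₀ w) (L₀ z) + ∑ i, F i (L i w) (L i z))
      ((fderiv ℝ (fun w => F₀ w (L₀ z)) (L₀ x)).comp L₀
        + ∑ i, (fderiv ℝ (fun w => F i w (L i z)) (L i x)).comp (L i)) x := fun x hx z hz =>
    ((hF₀.differentiableAt hU₀ (hLX₀ z hz) (hLU₀ x hx)).hasFDerivAt.comp x L₀.hasFDerivAt).add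
      (HasFDerivAt.fun_sum fun i _ => ((hF i).differentiableAt (hU' i) (hLX i z hz)
        (hLU i x hx)).hasFDerivAt.comp x (L i).hasFDerivAt)
  refine ⟨fun z hz => ?_, ?_, fun z hz => ?_, ?_⟩
  · exact ((hF₀.contDiff _ (hLX₀ z hz)).comp L₀.contDiff.contDiffOn hLU₀).add
      (ContDiffOn.sum fun i _ =>
        ((hF i).contDiff _ (hLX i z hz)).comp (L i).contDiff.contDiffOn (hLU i))
  · obtain ⟨c₀, hc₀, hm₀⟩ := hF₀.stronglyConvex
    choose c hc hm using fun i => (hF i).stronglyConvex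
    obtain ⟨e, he, he₀, hei⟩ : ∃ e : ℝ, 0 < e ∧ e ≤ c₀ ∧ ∀ i, e ≤ c i := by
      -- Adjoining `c₀` through `Option` keeps the set of moduli nonempty even when there are no
      -- blocks.
      obtain ⟨e, he⟩ := (Set.finite_range (fun o : Option ι => o.elim c₀ c)).exists_minimal
        (Set.range_nonempty _)
      have hle : ∀ o : Option ι, e ≤ o.elim c₀ c := fun o =>
        (le_total e (o.elim c₀ c)).elim id fun h => he.2 ⟨o, rfl⟩ h
      refine ⟨e, ?_, hle none, fun i => hle (some i)⟩
      obtain ⟨o, rfl⟩ := he.1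
      cases o with
      | none => exact hc₀
      | some i => exact hc i
    refine ⟨e, he, fun z hz x hx y hy => ?_⟩
    rw [(hfd x (hXU hx) z hz).fderiv, (hfd y (hXU hy) z hz).fderiv]
    have h0 := hm₀ _ (hLX₀ z hz) _ (hLX₀ x hx) _ (hLX₀ y hy)
    have hi := fun i => hm i _ (hLX i z hz) _ (hLX i x hx) _ (hLX i y hy)
    calc e * ‖x - y‖ ^ 2 ≤ e * (‖L₀ (x - y)‖ ^ 2 + ∑ i, ‖L i (x - y)‖ ^ 2) := by
          gcongr
          exact hnorm _
      _ = e * ‖L₀ x - L₀ y‖ ^ 2 + ∑ i, e * ‖L i x - L i y‖ ^ 2 := by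
          simp only [map_sub, mul_add, Finset.mul_sum]
      _ ≤ c₀ * ‖L₀ x - L₀ y‖ ^ 2 + ∑ i, c i * ‖L i x - L i y‖ ^ 2 := by
          gcongr with i
          exact hei i
      _ ≤ _ := by
          refine (add_le_add h0 (Finset.sum_le_sum fun i _ => hi i)).trans_eq ?_
          simp [Finset.sum_sub_distrib]
          ring
  · rw [(hfd z (hXU hz) z hz).fderiv, hF₀.grad_eq _ (hLX₀ z hz)]
    simp only [fun i => (hF i).grad_eq _ (hLX i z hz)]
    refine (HasFDerivAt.fderiv ?_).symm
    exact ((hf₀ _ (hLU₀ z (hXU hz))).hasFDerivAt.comp z L₀.hasFDerivAt).add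
      (HasFDerivAt.fun_sum fun i _ => (hf i _ (hLU i z (hXU hz))).hasFDerivAt.comp z
        (L i).hasFDerivAt)
  · have h1 : ContinuousOn (fun p : E × E =>
        (fderiv ℝ (fun w => F₀ w (L₀ p.2)) (L₀ p.1)).comp L₀
        + ∑ i, (fderiv ℝ (fun w => F i w (L i p.2)) (L i p.1)).comp (L i)) (U ×ˢ X) := by
      refine ContinuousOn.add (ContinuousOn.clm_comp ?_ continuousOn_const)
        (continuousOn_finsetSum _ fun i _ => ContinuousOn.clm_comp ?_ continuousOn_const)
      · exact hF₀.grad_continuous.comp (f := fun p : E × E => (L₀ p.1, L₀ p.2)) (by fun_prop)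
          fun p hp => ⟨hLU₀ _ hp.1, hLX₀ _ hp.2⟩
      · exact (hF i).grad_continuous.comp (f := fun p : E × E => (L i p.1, L i p.2)) (by fun_prop)
          fun p hp => ⟨hLU i _ hp.1, hLX i _ hp.2⟩
    exact h1.congr fun p hp => (hfd p.1 hp.1 p.2 hp.2).fderiv

/-- Sums of pullbacks of functions with a quadratic upper bound have a quadratic upper bound. -/
theorem exists_quadratic_bound_add_sum {ι : Type} [Fintype ι] {D : ι → Type}
    [∀ i, NormedAddCommGroup (D i)] [∀ i, NormedSpace ℝ (D i)] {X : Set E}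
    {X₀ : Set E'} (hX₀ : Convex ℝ X₀) {f₀ : E' → ℝ} (hf₀ : ∀ x ∈ X₀, DifferentiableAt ℝ f₀ x)
    (hK₀ : ∃ K, LipschitzOnWith K (fderiv ℝ f₀) X₀)
    {X' : ∀ i, Set (D i)} (hX' : ∀ i, Convex ℝ (X' i)) {f : ∀ i, D i → ℝ}
    (hf : ∀ i, ∀ x ∈ X' i, DifferentiableAt ℝ (f i) x)
    (hK : ∀ i, ∃ K, LipschitzOnWith K (fderiv ℝ (f i)) (X' i))
    (L₀ : E →L[ℝ] E') (L : ∀ i, E →L[ℝ] D i)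
    (hLX₀ : ∀ x ∈ X, L₀ x ∈ X₀) (hLX : ∀ i, ∀ x ∈ X, L i x ∈ X' i) :
    ∃ K : ℝ, ∀ x ∈ X, ∀ y ∈ X, f₀ (L₀ y) + ∑ i, f i (L i y) ≤ f₀ (L₀ x) + ∑ i, f i (L i x)
      + fderiv ℝ (fun x => f₀ (L₀ x) + ∑ i, f i (L i x)) x (y - x) + K * ‖y - x‖ ^ 2 := by
  obtain ⟨K₀, hK₀⟩ := hK₀
  choose K hK using hK
  refine ⟨K₀ * ‖L₀‖ ^ 2 + ∑ i, K i * ‖L i‖ ^ 2, fun x hx y hy => ?_⟩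
  have hfd : HasFDerivAt (fun x => f₀ (L₀ x) + ∑ i, f i (L i x))
      ((fderiv ℝ f₀ (L₀ x)).comp L₀ + ∑ i, (fderiv ℝ (f i) (L i x)).comp (L i)) x :=
    ((hf₀ _ (hLX₀ x hx)).hasFDerivAt.comp x L₀.hasFDerivAt).add
      (HasFDerivAt.fun_sum fun i _ => (hf i _ (hLX i x hx)).hasFDerivAt.comp x
        (L i).hasFDerivAt)
  rw [hfd.fderiv]
  have h0 : f₀ (L₀ y) ≤ f₀ (L₀ x) + fderiv ℝ f₀ (L₀ x) (L₀ (y - x))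
      + K₀ * ‖L₀‖ ^ 2 * ‖y - x‖ ^ 2 := by
    have := hK₀.le_add_fderiv_add_sq hX₀ hf₀ (hLX₀ x hx) (hLX₀ y hy)
    rw [← map_sub] at this
    refine this.trans ?_
    rw [mul_assoc, ← mul_pow]
    gcongr
    exact L₀.le_opNorm _
  have hi : ∀ i, f i (L i y) ≤ f i (L i x) + fderiv ℝ (f i) (L i x) (L i (y - x))
      + K i * ‖L i‖ ^ 2 * ‖y - x‖ ^ 2 := fun i => by
    have := (hK i).le_add_fderiv_add_sq (hX' i) (hf i) (hLX i x hx) (hLX i y hy)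
    rw [← map_sub] at this
    refine this.trans ?_
    rw [mul_assoc, ← mul_pow]
    gcongr
    exact (L i).le_opNorm _
  refine (add_le_add h0 (Finset.sum_le_sum fun i _ => hi i)).trans_eq ?_
  simp only [add_apply, sum_apply, ContinuousLinearMap.comp_apply, Finset.sum_add_distrib,
    add_mul, Finset.sum_mul]
  ring

end Pullback

/-! ### The decomposed problem as one joint problem. -/

theorem isOpen_pairSet {n m : ℕ} {A : Set (Vec n)} {B : Set (Vec m)} (hA : IsOpen A)
    (hB : IsOpen B) : IsOpen (pairSet A B) :=
  (hA.preimage (f := fun p : VecPair n m => p.fst) (by fun_prop)).inter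
    (hB.preimage (f := fun p : VecPair n m => p.snd) (by fun_prop))

theorem convex_pairSet {n m : ℕ} {A : Set (Vec n)} {B : Set (Vec m)} (hA : Convex ℝ A)
    (hB : Convex ℝ B) : Convex ℝ (pairSet A B) :=
  fun _ hx _ hy _ _ ha hb hab => ⟨hA hx.1 hy.1 ha hb hab, hB hx.2 hy.2 ha hb hab⟩

namespace SPDProblem

variable (P : SPDProblem)

/-- The projection `(x, y) ↦ y`. -/
def projY : P.Space →L[ℝ] Vec P.n₀ := ContinuousLinearMap.snd ℝ _ _

/-- The projection `(x, y) ↦ xᵢ`. -/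
def projX (i : Fin P.I) : P.Space →L[ℝ] Vec (P.n i) :=
  (ContinuousLinearMap.proj i).comp (ContinuousLinearMap.fst ℝ _ _)

/-- The projection `(x, y) ↦ (xᵢ, y)`. -/
def projPair (i : Fin P.I) : P.Space →L[ℝ] VecPair (P.n i) P.n₀ :=
  ((WithLp.prodContinuousLinearEquiv 2 ℝ (Vec (P.n i)) (Vec P.n₀)).symm :
    _ →L[ℝ] VecPair (P.n i) P.n₀).comp ((P.projX i).prod P.projY)

theorem projY_apply (z : P.Space) : P.projY z = z.2 := rfl

theorem projX_apply (i : Fin P.I) (z : P.Space) : P.projX i z = z.1 i := rfl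

/-- The joint space carries the max norm and the pairs the `ℓ₂` norm. Every component of `z` occurs
in some projection, and `projY` covers `y` even if `I = 0`; strong convexity of the terms thus adds
up to that of the whole. -/
theorem norm_sq_le_projections (z : P.Space) :
    ‖z‖ ^ 2 ≤ ‖P.projY z‖ ^ 2 + ∑ i, ‖P.projPair i z‖ ^ 2 := by
  have hnn : ∀ i ∈ Finset.univ, 0 ≤ ‖P.projPair i z‖ ^ 2 := fun i _ => by positivity
  have hsum : 0 ≤ ∑ i, ‖P.projPair i z‖ ^ 2 := Finset.sum_nonneg hnn
  rw [← Real.le_sqrt (norm_nonneg _) (by positivity)]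
  refine max_le ?_ ?_
  · refine (pi_norm_le_iff_of_nonneg (Real.sqrt_nonneg _)).2 fun i => ?_
    refine Real.le_sqrt_of_sq_le ?_
    have h1 := Finset.single_le_sum hnn (Finset.mem_univ i)
    have h2 : ‖P.projPair i z‖ ^ 2 = ‖z.1 i‖ ^ 2 + ‖z.2‖ ^ 2 := WithLp.prod_norm_sq_eq_of_L2 _
    nlinarith [sq_nonneg ‖z.2‖, sq_nonneg ‖P.projY z‖]
  · refine Real.le_sqrt_of_sq_le ?_
    rw [P.projY_apply]
    linarith

theorem eqn_affine (l : P.EqIdx) :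
    ∃ (A : P.Space →L[ℝ] ℝ) (c : ℝ), ∀ z, P.eqn l z = A z + c := by
  refine ⟨LinearMap.toContinuousLinearMap
    { toFun := fun z => (P.Ax l.1 *ᵥ (z.1 l.1).ofLp + P.Ay l.1 *ᵥ z.2.ofLp) l.2
      map_add' := fun z z' => ?_
      map_smul' := fun c z => ?_ }, P.b l.1 l.2, fun z => rfl⟩
  · simp [Matrix.mulVec_add]
    ring
  · simp [Matrix.mulVec_smul]
    ring

/-- The open set `U₁ × ⋯ × U_I × V`. -/
def openSet : Set P.Space := {z | (∀ i, z.1 i ∈ P.U i) ∧ z.2 ∈ P.V}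

variable {P}

namespace Assumptions

theorem isOpen_openSet (hP : P.Assumptions) : IsOpen P.openSet := by
  have h : P.openSet = (⋂ i, P.projX i ⁻¹' P.U i) ∩ P.projY ⁻¹' P.V := by
    ext z
    simp [openSet, projX_apply, projY_apply]
  rw [h]
  exact (isOpen_iInter_of_finite fun i => (hP.U_open i).preimage (P.projX i).continuous).inter
    (hP.V_open.preimage P.projY.continuous)

theorem isClosed_convexSet (hP : P.Assumptions) : IsClosed P.convexSet := by
  have h : P.convexSet = (⋂ i, P.projX i ⁻¹' P.X i) ∩ P.projY ⁻¹' P.Y := by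
    ext z
    simp [convexSet, projX_apply, projY_apply]
  rw [h]
  exact (isClosed_iInter fun i => (hP.X_closed i).preimage (P.projX i).continuous).inter
    (hP.Y_closed.preimage P.projY.continuous)

theorem convex_convexSet (hP : P.Assumptions) : Convex ℝ P.convexSet :=
  fun _ hx _ hy _ _ ha hb hab =>
    ⟨fun i => hP.X_convex i (hx.1 i) (hy.1 i) ha hb hab, hP.Y_convex hx.2 hy.2 ha hb hab⟩

theorem convexSet_subset (hP : P.Assumptions) : P.convexSet ⊆ P.openSet :=
  fun _ hz => ⟨fun i => hP.X_subset i (hz.1 i), hP.Y_subset hz.2⟩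

theorem pairSet_subset (hP : P.Assumptions) (i : Fin P.I) :
    pairSet (P.X i) P.Y ⊆ pairSet (P.U i) P.V :=
  fun _ hz => ⟨hP.X_subset i hz.1, hP.Y_subset hz.2⟩

theorem isOpen_pair (hP : P.Assumptions) (i : Fin P.I) : IsOpen (pairSet (P.U i) P.V) :=
  isOpen_pairSet (hP.U_open i) hP.V_open

end Assumptions

theorem _root_.ContDiffOn.differentiableAt_of_isOpen {E : Type*} [NormedAddCommGroup E]
    [NormedSpace ℝ E] {f : E → ℝ} {U : Set E} (hf : ContDiffOn ℝ 1 f U) (hU : IsOpen U) {x : E}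
    (hx : x ∈ U) : DifferentiableAt ℝ f x :=
  (hf.contDiffAt (hU.mem_nhds hx)).differentiableAt one_ne_zero

theorem _root_.ContDiffOn.continuousAt_comp_continuousLinearMap {E E' : Type*}
    [NormedAddCommGroup E] [NormedSpace ℝ E] [NormedAddCommGroup E'] [NormedSpace ℝ E']
    {f : E' → ℝ} {U : Set E'} (hf : ContDiffOn ℝ 1 f U) (hU : IsOpen U) (L : E →L[ℝ] E') {x : E}
    (hx : L x ∈ U) : ContinuousAt (fun x => f (L x)) x :=
  ContinuousAt.comp (hf.contDiffAt (hU.mem_nhds hx)).continuousAt L.continuous.continuousAt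

namespace Approx

variable (S : P.Approx)

/-- The approximation of the whole objective. -/
def objective (x z : P.Space) : ℝ :=
  S.F₀ x.2 z.2 + ∑ i, S.F i (mkPair (x.1 i) x.2) (mkPair (z.1 i) z.2)

/-- The approximations of all inequality constraint functions. -/
def ineq : P.IneqIdx → P.Space → P.Space → ℝ
  | Sum.inl ⟨i, j⟩, x, z => S.Gc i j (mkPair (x.1 i) x.2) (mkPair (z.1 i) z.2)
  | Sum.inr (Sum.inl ⟨i, j⟩), x, z => S.G i j (x.1 i) (z.1 i)
  | Sum.inr (Sum.inr j), x, z => S.G₀ j x.2 z.2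

variable {S}

theorem IsAdmissible.objective (hS : S.IsAdmissible) (hP : P.Assumptions) :
    IsObjectiveSurrogate P.openSet P.convexSet P.objective S.objective :=
  IsObjectiveSurrogate.add_sum hP.convexSet_subset hS.F₀ hP.V_open
    (fun _ hx => hP.f₀_contDiff.differentiableAt_of_isOpen hP.V_open hx) hS.F hP.isOpen_pair
    (fun i _ hx => (hP.f_contDiff i).differentiableAt_of_isOpen (hP.isOpen_pair i) hx)
    P.projY P.projPair (fun _ hx => hx.2) (fun _ hx => hx.2) (fun i _ hx => ⟨hx.1 i, hx.2⟩)
    (fun i _ hx => ⟨hx.1 i, hx.2⟩) P.norm_sq_le_projections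

theorem IsAdmissible.ineq (hS : S.IsAdmissible) (hP : P.Assumptions) (j : P.IneqIdx) :
    IsConstraintSurrogate P.convexSet (P.ineq j) (S.ineq j) := by
  match j with
  | Sum.inl ⟨i, j⟩ =>
    exact (hS.Gc i j).comp_continuousLinearMap (P.projPair i) hP.convex_convexSet
      (fun x hx => ⟨hx.1 i, hx.2⟩) fun x hx =>
        (hP.gc_contDiff i j).differentiableAt_of_isOpen (hP.isOpen_pair i)
          (hP.pairSet_subset i hx)
  | Sum.inr (Sum.inl ⟨i, j⟩) =>
    exact (hS.G i j).comp_continuousLinearMap (P.projX i) hP.convex_convexSet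
      (fun x hx => hx.1 i) fun x hx =>
        (hP.g_contDiff i j).differentiableAt_of_isOpen (hP.U_open i) (hP.X_subset i hx)
  | Sum.inr (Sum.inr j) =>
    exact (hS.G₀ j).comp_continuousLinearMap P.projY hP.convex_convexSet
      (fun x hx => hx.2) fun x hx =>
        (hP.g₀_contDiff j).differentiableAt_of_isOpen hP.V_open (hP.Y_subset hx)

/-- Once `y` is fixed no constraint links two different blocks, so decomposition loses nothing. -/
theorem mem_surrogateFeasible_iff (x w : P.Space) :
    x ∈ surrogateFeasible S.ineq P.eqn P.convexSet w ↔
      (x.2 ∈ P.Y ∧ ∀ j, S.G₀ j x.2 w.2 ≤ 0) ∧ ∀ i, x.1 i ∈ S.subFeasible w i x.2 := by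
  constructor
  · rintro ⟨h1, h2, h3⟩
    exact ⟨⟨h3.2, fun j => h1 (Sum.inr (Sum.inr j))⟩, fun i => ⟨fun j => h1 (Sum.inl ⟨i, j⟩),
      funext fun l => h2 ⟨i, l⟩, fun j => h1 (Sum.inr (Sum.inl ⟨i, j⟩)), h3.1 i⟩⟩
  · rintro ⟨⟨h1, h2⟩, h3⟩
    refine ⟨?_, fun l => congrFun (h3 l.1).2.1 l.2, fun i => (h3 i).2.2.2, h1⟩
    rintro (⟨i, j⟩ | ⟨i, j⟩ | j)
    · exact (h3 i).1 j
    · exact (h3 i).2.2.1 j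
    · exact h2 j

/-- Optimal points of the master problem and its subproblems together solve the joint convex
approximate problem. -/
theorem isOptimalOn_of_master {w : P.Space} {xs : Vec P.n₀ → P.XSpace} {y : Vec P.n₀}
    (hsub : ∀ y ∈ S.masterFeasible w, ∀ i,
      IsOptimalOn (S.subObjective w i y) (S.subFeasible w i y) (xs y i))
    (hmaster : IsOptimalOn (S.masterObjective w xs) (S.masterFeasible w) y) :
    IsOptimalOn (fun x => S.objective x w) (surrogateFeasible S.ineq P.eqn P.convexSet w)
      (xs y, y) := by
  refine ⟨(mem_surrogateFeasible_iff _ _).2 ⟨⟨hmaster.1.1, hmaster.1.2.1⟩,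
    fun i => (hsub y hmaster.1 i).1⟩, fun x hx => ?_⟩
  obtain ⟨⟨h1, h2⟩, h3⟩ := (mem_surrogateFeasible_iff _ _).1 hx
  -- The blocks of a jointly feasible point witness feasibility of the subproblems at its `y`;
  -- master optimality, then subproblem optimality, compare the values.
  have hx2 : x.2 ∈ S.masterFeasible w := ⟨h1, h2, fun i => ⟨x.1 i, h3 i⟩⟩
  refine (hmaster.2 x.2 hx2).trans ?_
  exact add_le_add le_rfl (Finset.sum_le_sum fun i _ => (hsub x.2 hx2 i).2 _ (h3 i))

end Approx

theorem Assumptions.continuousAt_ineq (hP : P.Assumptions) (j : P.IneqIdx) {z : P.Space}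
    (hz : z ∈ P.convexSet) : ContinuousAt (P.ineq j) z := by
  match j with
  | Sum.inl ⟨i, j⟩ =>
    exact (hP.gc_contDiff i j).continuousAt_comp_continuousLinearMap (hP.isOpen_pair i)
      (P.projPair i) (hP.pairSet_subset i ⟨hz.1 i, hz.2⟩)
  | Sum.inr (Sum.inl ⟨i, j⟩) =>
    exact (hP.g_contDiff i j).continuousAt_comp_continuousLinearMap (hP.U_open i)
      (P.projX i) (hP.X_subset i (hz.1 i))
  | Sum.inr (Sum.inr j) =>
    exact (hP.g₀_contDiff j).continuousAt_comp_continuousLinearMap hP.V_open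
      P.projY (hP.Y_subset hz.2)

theorem Assumptions.exists_quadratic_bound (hP : P.Assumptions) :
    ∃ K : ℝ, ∀ x ∈ P.convexSet, ∀ y ∈ P.convexSet, P.objective y ≤ P.objective x
      + fderiv ℝ P.objective x (y - x) + K * ‖y - x‖ ^ 2 :=
  exists_quadratic_bound_add_sum hP.Y_convex
    (fun _ hx => hP.f₀_contDiff.differentiableAt_of_isOpen hP.V_open (hP.Y_subset hx))
    hP.f₀_lipschitz (fun i => convex_pairSet (hP.X_convex i) hP.Y_convex)
    (fun i _ hx => (hP.f_contDiff i).differentiableAt_of_isOpen (hP.isOpen_pair i)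
      (hP.pairSet_subset i hx)) hP.f_lipschitz P.projY P.projPair (fun _ hx => hx.2)
    (fun i _ hx => ⟨hx.1 i, hx.2⟩)

end SPDProblem

/-! ### Existence of a limit point and conclusion. -/

/-- If the norms do not diverge, some closed ball, compact here, is visited infinitely often. -/
theorem exists_mapClusterPt_of_not_tendsto_norm {E : Type*} [NormedAddCommGroup E] [ProperSpace E]
    {z : ℕ → E} (hz : ¬ Tendsto (fun k => ‖z k‖) atTop atTop) : ∃ p, MapClusterPt p atTop z := by
  obtain ⟨R, hR⟩ := not_forall.1 (mt tendsto_atTop.2 hz)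
  have hfr : ∃ᶠ k in atTop, z k ∈ Metric.closedBall (0 : E) R :=
    (not_eventually.1 hR).mono fun k hk => by
      rw [mem_closedBall_zero_iff]
      exact (not_le.1 hk).le
  obtain ⟨p, -, hp⟩ := (isCompact_closedBall (0 : E) R).exists_mapClusterPt_of_frequently hfr
  exact ⟨p, hp⟩

theorem mainTheorem6 (P : SPDProblem) (S : P.Approx)
    (hreg : P.FeasiblePointsRegular) (hP : P.Assumptions) (hS : S.IsAdmissible)
    (γ : ℕ → ℝ) (z : ℕ → P.Space) (xs : ℕ → Vec P.n₀ → P.XSpace) (ys : ℕ → Vec P.n₀)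
    (hrun : IsSPDM P S γ z xs ys)
    (hdiv : ¬ Tendsto (fun k => ‖z k‖) atTop atTop) :
    ∃ p : P.Space, MapClusterPt p atTop z ∧ P.IsStationary p := by
  obtain ⟨p, hp⟩ := exists_mapClusterPt_of_not_tendsto_norm hdiv
  obtain ⟨K, hK⟩ := hP.exists_quadratic_bound
  obtain ⟨B, hB⟩ := hP.bddBelow
  refine ⟨p, hp, isStationaryPoint_of_mapClusterPt hP.isOpen_openSet hP.convexSet_subset
    hP.convex_convexSet hP.isClosed_convexSet (hS.objective hP) (hS.ineq hP)
    (fun j _ hx => hP.continuousAt_ineq j hx) P.eqn_affine hK hB hreg hrun.step hrun.init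
    (fun k => SPDProblem.Approx.isOptimalOn_of_master (hrun.sub_opt k) (hrun.master_opt k))
    hrun.update hp⟩
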